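/- Let $G=(V,E)$ be a finite directed graph that is cycle-disjoint, i.e. every vertex belongs to at most one directed cycle of $G$ (cycles have pairwise distinct vertices and are taken up to rotation). Let $\mathbb R^E$ be the set of real matrices $\Lambda=(\lambda_{ij})_{i,j\in V}$ such that $I-\Lambda$ is invertible and $\lambda_{ij}=0$ whenever $i\to j\notin E$. For $\Lambda\in\mathbb R^E$ and a random vector $\varepsilon=(\varepsilon_i)_{i\in V}$ with independent, centered components having positive variances and finite third absolute moments, put $X=(I-\Lambda)^{-T}\varepsilon$ (the solution of $X=\Lambda^TX+\varepsilon$), $s_{ij}=\mathbb E[X_iX_j]$, $t_{ijk}=\mathbb E[X_iX_jX_k]$, and $$d_{uv}^{2\times2}=\det\begin{pmatrix}s_{uu}&s_{uv}\\ t_{uuu}&t_{uuv}\end{pmatrix}\qquad(u,v\in V).$$ Say that $d_{uv}^{2\times2}=0$ identically if it vanishes for every $\Lambda\in\mathbb R^E$ and every distribution of such an $\varepsilon$. A vertex $r$ is a root of $G$ if the only vertex having a directed path (of length $\ge0$) to $r$ is $r$ itself. Then for every $r\in V$: $d_{ru}^{2\times2}=0$ identically for all $u\in V$ if and only if $r$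 is a root of $G$. -/

import Mathlib

open MeasureTheory ProbabilityTheory

namespace LSEM

section Graph

variable {V : Type*}

/-- A directed cycle of `G`: a cyclic sequence of pairwise distinct vertices (so it is taken up to
rotation), at least one, in which each vertex has an edge of `G` to its successor. -/
def IsDirectedCycle (G : Digraph V) (c : Cycle V) : Prop :=
  c ≠ Cycle.nil ∧ c.Nodup ∧ c.Chain G.Adj

/-- Every vertex belongs to at most one directed cycle. -/
def CycleDisjoint (G : Digraph V) : Prop :=
  ∀ v : V, ∀ c c' : Cycle V,
    IsDirectedCycle G c → IsDirectedCycle G c' → v ∈ c → v ∈ c' → c = c'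

/-- The ancestors of `C`: the vertices with a directed path (of length at least zero) to some
vertex of `C`. -/
def anc (G : Digraph V) (C : Set V) : Set V :=
  {u | ∃ v ∈ C, Relation.ReflTransGen G.Adj u v}

/-- `C` is ancestral if it equals its set of ancestors. -/
def IsAncestral (G : Digraph V) (C : Set V) : Prop :=
  anc G C = C

/-- A vertex is a root if the set consisting of it alone is ancestral. -/
def IsRoot (G : Digraph V) (v : V) : Prop :=
  IsAncestral G {v}

end Graph

section Model

variable {V : Type*} [Fintype V] [DecidableEq V]

/-- The coefficient matrices of `G`: matrices `Λ` supported on the edges of `G` for which `I - Λ`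
is invertible. -/
def coeffMatrices (G : Digraph V) : Set (Matrix V V ℝ) :=
  {L | IsUnit (1 - L) ∧ ∀ i j, ¬ G.Adj i j → L i j = 0}

/-- `P` is the law of an admissible noise vector: a probability law on `ℝ^V` whose coordinates are
independent and centered, with finite third absolute moments and positive variances. -/
structure IsNoiseLaw (P : Measure (V → ℝ)) : Prop where
  isProbabilityMeasure : IsProbabilityMeasure P
  indep : iIndepFun (fun (i : V) (e : V → ℝ) => e i) P
  memLp : ∀ i, MemLp (fun e : V → ℝ => e i) 3 P
  centered : ∀ i, ∫ e, e i ∂P = 0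
  variance_pos : ∀ i, 0 < ∫ e, e i ^ 2 ∂P

/-- The solution `X = (I - Λ)^{-T} ε` of the structural equations `X = Λᵀ X + ε`. -/
noncomputable def solution (L : Matrix V V ℝ) (e : V → ℝ) : V → ℝ :=
  Matrix.mulVec ((1 - L)⁻¹).transpose e

/-- The second moments `s i j = E[X i * X j]`. -/
noncomputable def moment2 (L : Matrix V V ℝ) (P : Measure (V → ℝ)) (i j : V) : ℝ :=
  ∫ e, solution L e i * solution L e j ∂P

/-- The third moments `t i j k = E[X i * X j * X k]`. -/
noncomputable def moment3 (L : Matrix V V ℝ) (P : Measure (V → ℝ)) (i j k : V) : ℝ :=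
  ∫ e, solution L e i * solution L e j * solution L e k ∂P

/-- The determinant `d_{uv}^{2×2}` formed from the second and third moments of `X`. -/
noncomputable def det22 (L : Matrix V V ℝ) (P : Measure (V → ℝ)) (u v : V) : ℝ :=
  Matrix.det !![moment2 L P u u, moment2 L P u v; moment3 L P u u u, moment3 L P u u v]

/-- `d_{uv}^{2×2} = 0` identically: it vanishes for every choice of the coefficient matrix and of
the distribution of the noise. -/
def Det22VanishesIdentically (G : Digraph V) (u v : V) : Prop :=
  ∀ L ∈ coeffMatrices G, ∀ P : Measure (V → ℝ), IsNoiseLaw P → det22 L P u v = 0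

end Model

end LSEM

namespace LSEM

section Graph

variable {V : Type*} {G : Digraph V} {r : V}

/-! If `r` is a root, column `r` of `(1 - L)⁻¹` is supported at `r`, so `X_r = c ε_r`. Since the
noise is independent and centered, pairing `X_u` with a power of `ε_r` only sees the coefficient `b`
of `ε_r` in `X_u`. The columns of the determinant are then `(c² m₂, c³ m₃)` and `(c b m₂, c² b m₃)`,
which are proportional. If `r` is not a root, it has a parent `p ≠ r`. Keeping only the edge `p → r`
and taking skewed i.i.d. noise makes the determinant for the pair `(r, p)` nonzero. -/

/-- A root has no incoming edges, apart from a possible self-loop. -/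
theorem IsRoot.not_adj (hr : IsRoot G r) {i : V} (hi : i ≠ r) : ¬ G.Adj i r := by
  intro h
  have : i ∈ anc G {r} := ⟨r, rfl, Relation.ReflTransGen.single h⟩
  rw [show anc G {r} = {r} from hr] at this
  exact hi this

/-- A vertex which is not a root has a parent different from itself. -/
theorem exists_adj_ne_of_not_isRoot (hr : ¬ IsRoot G r) : ∃ p, p ≠ r ∧ G.Adj p r := by
  by_contra! h
  refine hr (Set.Subset.antisymm ?_ ?_)
  · rintro u ⟨v, rfl, huv⟩
    induction huv using Relation.ReflTransGen.head_induction_on with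
    | refl => rfl
    | head hab _ ih =>
      rw [Set.mem_singleton_iff] at ih ⊢
      subst ih
      by_contra hne
      exact h _ hne hab
  · rintro u rfl
    exact ⟨u, rfl, Relation.ReflTransGen.refl⟩

end Graph

section Root

variable {V : Type*} [Fintype V] [DecidableEq V] {G : Digraph V} {r : V} {L : Matrix V V ℝ}

/-- Only the noise of a root itself contributes to its value. -/
theorem IsRoot.inv_apply_eq_zero (hr : IsRoot G r) (hL : L ∈ coeffMatrices G) {k : V}
    (hk : k ≠ r) : (1 - L)⁻¹ k r = 0 := by
  have hdet : IsUnit (1 - L).det := (Matrix.isUnit_iff_isUnit_det _).1 hL.1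
  have hcol : ∀ i, i ≠ r → (1 - L) i r = 0 := fun i hi => by
    simp [Matrix.one_apply_ne hi, hL.2 i r (hr.not_adj hi)]
  -- Column `r` of `1 - L` has only its diagonal entry, so the product collapses to one term. A
  -- self-loop may make that entry differ from `1`; it is nonzero because row `r` would otherwise
  -- read `0 = 1`.
  have key : ∀ i, (1 - L)⁻¹ i r * (1 - L) r r = (1 : Matrix V V ℝ) i r := fun i => by
    have h := congrFun (congrFun (Matrix.nonsing_inv_mul _ hdet) i) r
    rwa [Matrix.mul_apply, Finset.sum_eq_single r (fun j _ hj => by rw [hcol j hj, mul_zero])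
      fun h => absurd (Finset.mem_univ r) h] at h
  have hne : (1 - L) r r ≠ 0 := fun h => by simpa [h] using key r
  have h := key k
  rw [Matrix.one_apply_ne hk] at h
  exact (mul_eq_zero.1 h).resolve_right hne

theorem solution_apply (L : Matrix V V ℝ) (e : V → ℝ) (u : V) :
    solution L e u = ∑ k, (1 - L)⁻¹ k u * e k := rfl

theorem IsRoot.solution_eq (hr : IsRoot G r) (hL : L ∈ coeffMatrices G) (e : V → ℝ) :
    solution L e r = (1 - L)⁻¹ r r * e r := by
  rw [solution_apply]
  exact Finset.sum_eq_single r
    (fun k _ hk => by rw [hr.inv_apply_eq_zero hL hk, zero_mul]) (by simp)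

end Root

section Noise

variable {V : Type*} {P : Measure (V → ℝ)}

theorem IsNoiseLaw.integrable_pow (hP : IsNoiseLaw P) (i : V) {n : ℕ} (hn : n ≤ 3) :
    Integrable (fun e : V → ℝ => e i ^ n) P := by
  have := hP.isProbabilityMeasure
  have hm : MemLp (fun e : V → ℝ => e i) n P :=
    (hP.memLp i).mono_exponent (by exact_mod_cast hn)
  refine (integrable_norm_iff (Measurable.aestronglyMeasurable (by fun_prop))).1 ?_
  simpa only [norm_pow] using hm.integrable_norm_pow'

theorem IsNoiseLaw.indepFun_pow (hP : IsNoiseLaw P) {i j : V} (hij : i ≠ j) (m n : ℕ) :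
    IndepFun (fun e : V → ℝ => e i ^ m) (fun e : V → ℝ => e j ^ n) P :=
  (hP.indep.indepFun hij).comp (φ := fun x : ℝ => x ^ m) (ψ := fun x : ℝ => x ^ n)
    (by fun_prop) (by fun_prop)

theorem IsNoiseLaw.integrable_pow_mul_pow (hP : IsNoiseLaw P) {i j : V} (hij : i ≠ j) {m n : ℕ}
    (hm : m ≤ 3) (hn : n ≤ 3) : Integrable (fun e : V → ℝ => e i ^ m * e j ^ n) P :=
  (hP.indepFun_pow hij m n).integrable_mul (hP.integrable_pow i hm) (hP.integrable_pow j hn)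

theorem IsNoiseLaw.integral_pow_mul_pow (hP : IsNoiseLaw P) {i j : V} (hij : i ≠ j) (m n : ℕ) :
    ∫ e, e i ^ m * e j ^ n ∂P = (∫ e, e i ^ m ∂P) * ∫ e, e j ^ n ∂P :=
  (hP.indepFun_pow hij m n).integral_fun_mul_eq_mul_integral
    (Measurable.aestronglyMeasurable (by fun_prop)) (Measurable.aestronglyMeasurable (by fun_prop))

variable [Fintype V] [DecidableEq V]

/-- The mixed moment of a power of the noise at `r` and the solution at `u` only sees the
contribution of the noise at `r` to the solution. -/
theorem IsNoiseLaw.integral_pow_mul_solution (hP : IsNoiseLaw P) (L : Matrix V V ℝ) (r u : V)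
    {n : ℕ} (hn : n ≤ 2) :
    ∫ e, e r ^ n * solution L e u ∂P = (1 - L)⁻¹ r u * ∫ e, e r ^ (n + 1) ∂P := by
  have hint : ∀ k, Integrable (fun e : V → ℝ => e r ^ n * e k) P := fun k => by
    by_cases hk : r = k
    · subst hk
      simpa only [pow_succ] using hP.integrable_pow r (n := n + 1) (by omega)
    · simpa only [pow_one] using
        hP.integrable_pow_mul_pow hk (m := n) (n := 1) (by omega) (by omega)
  have hsum : ∀ e : V → ℝ,
      e r ^ n * solution L e u = ∑ k, (1 - L)⁻¹ k u * (e r ^ n * e k) := fun e => by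
    rw [solution_apply, Finset.mul_sum]
    exact Finset.sum_congr rfl fun k _ => by ring
  simp_rw [hsum]
  rw [integral_finsetSum _ fun k _ => (hint k).const_mul _]
  simp_rw [integral_const_mul]
  rw [Finset.sum_eq_single r _ (by simp)]
  · simp only [pow_succ]
  -- By independence, each term with `k ≠ r` contains the factor `E[ε_k] = 0`.
  · intro k _ hk
    have h := hP.integral_pow_mul_pow hk.symm n 1
    simp only [pow_one] at h
    rw [h, hP.centered k, mul_zero, mul_zero]

/-- If `r` is a root, then `d_{ru}^{2×2} = 0` identically for all `u`. -/
theorem IsRoot.det22VanishesIdentically {G : Digraph V} {r : V} (hr : IsRoot G r) (u : V) :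
    Det22VanishesIdentically G r u := by
  intro L hL P hP
  set c := (1 - L)⁻¹ r r with hc
  have h2 : ∀ v, moment2 L P r v = c * ((1 - L)⁻¹ r v * ∫ e, e r ^ 2 ∂P) := fun v => by
    rw [← hP.integral_pow_mul_solution L r v (n := 1) (by omega), ← integral_const_mul]
    refine integral_congr_ae (.of_forall fun e => ?_)
    simp only [hr.solution_eq hL e, ← hc]
    ring
  have h3 : ∀ v, moment3 L P r r v = c ^ 2 * ((1 - L)⁻¹ r v * ∫ e, e r ^ 3 ∂P) := fun v => by
    rw [← hP.integral_pow_mul_solution L r v (n := 2) (by omega), ← integral_const_mul]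
    refine integral_congr_ae (.of_forall fun e => ?_)
    simp only [hr.solution_eq hL e, ← hc]
    ring
  rw [det22, Matrix.det_fin_two_of, h2, h2, h3, h3, ← hc]
  ring

end Noise

section SkewedNoise

/-- The centered law on `ℝ` with mass `2/3` at `-1` and mass `1/3` at `2`. -/
noncomputable def skewedLaw : Measure ℝ :=
  ENNReal.ofReal (2 / 3) • Measure.dirac (-1) + ENNReal.ofReal (1 / 3) • Measure.dirac 2

instance : IsProbabilityMeasure skewedLaw := by
  constructor
  simp only [skewedLaw, Measure.add_apply, Measure.smul_apply, measure_univ, smul_eq_mul, mul_one]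
  rw [← ENNReal.ofReal_add (by norm_num) (by norm_num)]
  norm_num

theorem integral_skewedLaw (f : ℝ → ℝ) :
    ∫ x, f x ∂skewedLaw = 2 / 3 * f (-1) + 1 / 3 * f 2 := by
  have h : ∀ (c a : ℝ), Integrable f (ENNReal.ofReal c • Measure.dirac a) := fun c a =>
    (integrable_dirac (by simp)).smul_measure ENNReal.ofReal_ne_top
  rw [skewedLaw, integral_add_measure (h _ _) (h _ _), integral_smul_measure,
    integral_smul_measure, integral_dirac, integral_dirac,
    ENNReal.toReal_ofReal (by norm_num), ENNReal.toReal_ofReal (by norm_num)]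
  simp only [smul_eq_mul]

theorem memLp_id_skewedLaw : MemLp (fun x : ℝ => x) 3 skewedLaw := by
  refine MemLp.of_bound (by fun_prop) 2 ?_
  rw [skewedLaw, ae_add_measure_iff]
  constructor <;> refine Measure.ae_smul_measure ?_ _ <;> rw [ae_dirac_eq] <;>
    simp

variable (V : Type*) [Fintype V]

/-- The law of a noise vector with independent coordinates, each distributed as `skewedLaw`. -/
noncomputable def skewedNoise : Measure (V → ℝ) :=
  Measure.pi fun _ => skewedLaw

variable {V}

theorem integral_pow_skewedNoise (i : V) (n : ℕ) :
    ∫ e, e i ^ n ∂skewedNoise V = 2 / 3 * (-1) ^ n + 1 / 3 * 2 ^ n := by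
  rw [skewedNoise, integral_comp_eval (μ := fun _ : V => skewedLaw) (f := fun x : ℝ => x ^ n)
    (by fun_prop), integral_skewedLaw]

theorem isNoiseLaw_skewedNoise : IsNoiseLaw (skewedNoise V) where
  isProbabilityMeasure := by unfold skewedNoise; infer_instance
  indep := iIndepFun_pi (μ := fun _ : V => skewedLaw) (X := fun _ x => x) fun _ => by fun_prop
  memLp i := memLp_id_skewedLaw.comp_measurePreserving (measurePreserving_eval _ i)
  centered i := by
    have h := integral_pow_skewedNoise i 1
    simp only [pow_one] at h
    rw [h]
    norm_num
  variance_pos i := by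
    rw [integral_pow_skewedNoise]
    norm_num

end SkewedNoise

section SingleEdge

variable {V : Type*} [Fintype V] [DecidableEq V] {p r : V}

/-- The single-edge matrix squares to zero because `p ≠ r`, so the Neumann series for the inverse
stops after the linear term. -/
theorem one_add_single_mul_one_sub_single (hpr : p ≠ r) :
    (1 + Matrix.single p r (2 : ℝ)) * (1 - Matrix.single p r 2) = 1 := by
  have h : Matrix.single p r (2 : ℝ) * Matrix.single p r 2 = 0 :=
    Matrix.single_mul_single_of_ne _ _ _ _ hpr.symm _
  rw [add_mul, mul_sub, mul_sub, h]
  simp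

theorem single_mem_coeffMatrices {G : Digraph V} (hpr : p ≠ r) (h : G.Adj p r) :
    Matrix.single p r (2 : ℝ) ∈ coeffMatrices G := by
  refine ⟨IsUnit.of_mul_eq_one_right _ (one_add_single_mul_one_sub_single hpr), fun i j hij => ?_⟩
  refine Matrix.single_apply_of_ne _ _ _ _ _ ?_
  rintro ⟨rfl, rfl⟩
  exact hij h

theorem solution_single (hpr : p ≠ r) (e : V → ℝ) (u : V) :
    solution (Matrix.single p r 2) e u = e u + if u = r then 2 * e p else 0 := by
  rw [solution_apply, Matrix.inv_eq_left_inv (one_add_single_mul_one_sub_single hpr)]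
  simp only [Matrix.add_apply, add_mul, Finset.sum_add_distrib, Matrix.one_apply, ite_mul, one_mul,
    zero_mul, Finset.sum_ite_eq', Finset.mem_univ, if_true, Matrix.single_apply]
  congr 1
  by_cases hu : u = r
  · simp [hu]
  · simp [hu, Ne.symm hu]

/-- For edge weight `a` and i.i.d. noise with moments `m₂`, `m₃`, the determinant is `a (a - 1) m₂
m₃`. Hence the noise must be skewed, and weight `1` would fail. Here `a = m₂ = m₃ = 2`. -/
theorem det22_single_skewedNoise (hpr : p ≠ r) :
    det22 (Matrix.single p r 2) (skewedNoise V) r p = 8 := by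
  have hP : IsNoiseLaw (skewedNoise V) := isNoiseLaw_skewedNoise
  have hi : ∀ (c : ℝ) {m n : ℕ}, m ≤ 3 → n ≤ 3 →
      Integrable (fun e : V → ℝ => c * (e r ^ m * e p ^ n)) (skewedNoise V) :=
    fun c _ _ hm hn => (hP.integrable_pow_mul_pow hpr.symm hm hn).const_mul c
  -- Writing every monomial with both exponents, zero included, lets one factorization rule evaluate
  -- all the moments.
  have hm := fun (c : ℝ) (m n : ℕ) =>
    (integral_const_mul (μ := skewedNoise V) c (fun e : V → ℝ => e r ^ m * e p ^ n)).trans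
      (congrArg (c * ·) (hP.integral_pow_mul_pow hpr.symm m n))
  simp only [integral_pow_skewedNoise] at hm
  have hXr : ∀ e, solution (Matrix.single p r 2) e r = e r + 2 * e p := fun e => by
    rw [solution_single hpr, if_pos rfl]
  have hXp : ∀ e, solution (Matrix.single p r 2) e p = e p := fun e => by
    rw [solution_single hpr, if_neg hpr, add_zero]
  have hrr : moment2 (Matrix.single p r 2) (skewedNoise V) r r = 10 := by
    have h : ∀ e : V → ℝ, (e r + 2 * e p) * (e r + 2 * e p) =
        1 * (e r ^ 2 * e p ^ 0) + 4 * (e r ^ 1 * e p ^ 1) + 4 * (e r ^ 0 * e p ^ 2) :=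
      fun e => by ring
    simp_rw [moment2, hXr, h]
    rw [integral_add ((hi _ (by omega) (by omega)).fun_add (hi _ (by omega) (by omega)))
      (hi _ (by omega) (by omega)), integral_add (hi _ (by omega) (by omega))
      (hi _ (by omega) (by omega)), hm, hm, hm]
    norm_num
  have hrp : moment2 (Matrix.single p r 2) (skewedNoise V) r p = 4 := by
    have h : ∀ e : V → ℝ, (e r + 2 * e p) * e p =
        1 * (e r ^ 1 * e p ^ 1) + 2 * (e r ^ 0 * e p ^ 2) := fun e => by ring
    simp_rw [moment2, hXr, hXp, h]
    rw [integral_add (hi _ (by omega) (by omega)) (hi _ (by omega) (by omega)), hm, hm]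
    norm_num
  have hrrr : moment3 (Matrix.single p r 2) (skewedNoise V) r r r = 18 := by
    have h : ∀ e : V → ℝ, (e r + 2 * e p) * (e r + 2 * e p) * (e r + 2 * e p) =
        (1 * (e r ^ 3 * e p ^ 0) + 6 * (e r ^ 2 * e p ^ 1)) +
          (12 * (e r ^ 1 * e p ^ 2) + 8 * (e r ^ 0 * e p ^ 3)) := fun e => by ring
    simp_rw [moment3, hXr, h]
    rw [integral_add ((hi _ (by omega) (by omega)).fun_add (hi _ (by omega) (by omega)))
      ((hi _ (by omega) (by omega)).fun_add (hi _ (by omega) (by omega))),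
      integral_add (hi _ (by omega) (by omega)) (hi _ (by omega) (by omega)),
      integral_add (hi _ (by omega) (by omega)) (hi _ (by omega) (by omega)), hm, hm, hm, hm]
    norm_num
  have hrrp : moment3 (Matrix.single p r 2) (skewedNoise V) r r p = 8 := by
    have h : ∀ e : V → ℝ, (e r + 2 * e p) * (e r + 2 * e p) * e p =
        1 * (e r ^ 2 * e p ^ 1) + 4 * (e r ^ 1 * e p ^ 2) + 4 * (e r ^ 0 * e p ^ 3) :=
      fun e => by ring
    simp_rw [moment3, hXr, hXp, h]
    rw [integral_add ((hi _ (by omega) (by omega)).fun_add (hi _ (by omega) (by omega)))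
      (hi _ (by omega) (by omega)), integral_add (hi _ (by omega) (by omega))
      (hi _ (by omega) (by omega)), hm, hm, hm]
    norm_num
  rw [det22, Matrix.det_fin_two_of, hrr, hrp, hrrr, hrrp]
  norm_num

end SingleEdge

end LSEM

theorem mainTheorem8 {V : Type*} [Fintype V] [DecidableEq V] (G : Digraph V)
    (hG : LSEM.CycleDisjoint G) (r : V) :
    (∀ u : V, LSEM.Det22VanishesIdentically G r u) ↔ LSEM.IsRoot G r := by
  refine ⟨fun h => ?_, fun hr u => hr.det22VanishesIdentically u⟩
  by_contra hr
  obtain ⟨p, hpr, hp⟩ := LSEM.exists_adj_ne_of_not_isRoot hr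
  have h0 := h p _ (LSEM.single_mem_coeffMatrices hpr hp) _ LSEM.isNoiseLaw_skewedNoise
  rw [LSEM.det22_single_skewedNoise hpr] at h0
  norm_num at h0
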